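/- For $n\ge 2$ and $p,\eta\in[0,1]$ let $G^*\sim \mathrm{ER}(n,p)$ be the Erdős–Rényi random graph on $n$ labelled vertices (each pair is an edge independently with probability $p$), and let $G$ be the random subgraph obtained by retaining each edge of $G^*$ independently with probability $\eta$. For a graph $H$ write $N_H(u)$ for the set of neighbours of $u$ in $H$. For $c\in(0,1]$ the pair $(G,G^*)$ is called $c$-admissible if there is a connected component $C$ of $G$ such that, for every vertex $u$ with $N_{G^*}(u)\neq\emptyset$, $$\pi_u\big(N_{G^*}(u)\cap V(C)\big)=\frac{|N_{G^*}(u)\cap V(C)|}{|N_{G^*}(u)|}\ \ge\ c ,$$ where $\pi_u$ is the uniform probability distribution on $N_{G^*}(u)$. **Theorem.** There are an absolute constant $C_0>0$ and a function $\varepsilon(n)=o(n^{-2})$ such that, for all $n\ge 2$, all $p\in[0,1]$ with $p> C_0\frac{\log n}{n}$ and all $\eta\in\left(\frac1{\log n},1\right]$, the equation $\gamma=1-e^{-np\eta\gamma}$ has a unique solution $\gamma\in(0,1]$, and, with this $\gamma$, $$\Pr\big[(G,G^*)\text{ is }\gamma/3\text{-admissible}\big]\ \ge\ 1-\varepsilon(n).$$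 -/

import Mathlib

open MeasureTheory ProbabilityTheory

namespace KnowledgeGraph

/-- The distribution `π_u` of one query to the retrieval oracle at `u`:
the uniform probability distribution over the neighbours of `u` in `Gs`
(it is used only when `u` has a neighbour). -/
noncomputable def neighborDist {V : Type*} [MeasurableSpace V] (Gs : SimpleGraph V) (u : V) :
    Measure V :=
  uniformOn (Gs.neighborSet u)

/-- `γ`-admissibility of the pair formed by the ground-truth graph `Gs` and the prior graph `G`:
some connected component of `G` has, for every vertex `u` that is not isolated in `Gs`, mass at
least `γ` under the uniform distribution over the `Gs`-neighbours of `u`. -/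
def Admissible {V : Type*} [MeasurableSpace V] (Gs G : SimpleGraph V) (γ : ℝ) : Prop :=
  ∃ C : G.ConnectedComponent, ∀ u : V, (Gs.neighborSet u).Nonempty →
    γ ≤ (neighborDist Gs u).real (Gs.neighborSet u ∩ C.supp)

/-- The joint law of the pair `(Gs, G)`: `Gs` is the Erdős–Rényi graph with edge probability `p`
on the vertex set `Fin n`, and `G` retains each edge of `Gs` independently with probability `η`.
Each potential edge carries an independent retention mark of probability `η`; the marks form the
second graph `ω.2`, and the retained edges are the marked edges of `Gs`. -/
noncomputable def thinnedLaw (n : ℕ) (p η : unitInterval) :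
    Measure (SimpleGraph (Fin n) × SimpleGraph (Fin n)) :=
  ((SimpleGraph.binomialRandom (Fin n) p).prod (SimpleGraph.binomialRandom (Fin n) η)).map
    (fun ω => (ω.1, ω.1 ⊓ ω.2))

theorem measurable_thinning (n : ℕ) :
    Measurable (fun ω : SimpleGraph (Fin n) × SimpleGraph (Fin n) => (ω.1, ω.1 ⊓ ω.2)) := by
  refine measurable_fst.prodMk (SimpleGraph.measurable_iff_adj.2 fun u v => ?_)
  have h := SimpleGraph.measurable_iff_adj.1 (measurable_id (α := SimpleGraph (Fin n))) u v
  exact (h.comp measurable_fst).and (h.comp measurable_snd)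

instance isProbabilityMeasure_thinnedLaw (n : ℕ) (p η : unitInterval) :
    IsProbabilityMeasure (thinnedLaw n p η) :=
  Measure.isProbabilityMeasure_map (measurable_thinning n).aemeasurable

end KnowledgeGraph

/-!
Write `q = p η`. Since `η > 1 / log n` and `p > C₀ log n / n`, the retained graph `G` is a binomial
random graph with `n q > C₀`, while `G*` has mean degree above `C₀ log n`. For `C₀` large, `G` has,
with high probability, a component that contains at least a third of every `G*`-neighbourhood;
because `γ ≤ 1`, this is at least what is asked.

Two facts carry the argument. First, a union bound over pairs of vertex sets
(`measureReal_not_largeSetsJoined_le`) shows that, outside an event of probability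
`4 ^ n exp (-q n ^ 2 / 64)`, any two disjoint sets of at least `n / 8` vertices are joined by an
edge of `G`. In this case `G`, and `G - u` for every vertex `u`, has a component with more than
three quarters of the vertices (`LargeSetsJoined.exists_component`), and the giant component of
`G - u` is contained in that of `G`.

Second, the giant component `W` of `G - u` is independent of the `G*`-edges at `u`
(`indepFun_deleteIncidenceSet_neighborSet`). For a fixed `W`, let `X` and `Y` be the numbers of
`G*`-neighbours of `u` inside and outside `W`. The expectation of `2 ^ (Y - 2 X)` is at most
`exp (-p n / 4)`, hence so is the probability of `2 X < Y` (`measure_neighborSet_misses_le`,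
`measureReal_missedByGiant_le`). With `C₀ = 1000` this is far below `n ^ (-4)`, and a union bound
over `u` leaves a failure probability of at most `2 / n ^ 3`.

Existence of `γ` is the intermediate value theorem and its uniqueness is strict convexity of `exp`
(`existsUnique_survival`).
-/

namespace KnowledgeGraph

open unitInterval

/-! ### The edge indicators of the binomial random graph -/

theorem map_edgeSet_binomialRandom {V : Type*} [Countable V] (p : I) :
    (SimpleGraph.binomialRandom V p).map SimpleGraph.edgeSet =
      setBernoulli (Sym2.diagSetᶜ : Set (Sym2 V)) p := by
  rw [SimpleGraph.binomialRandom_eq_map, Measure.map_map SimpleGraph.measurable_edgeSet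
    SimpleGraph.measurable_fromEdgeSet, Measure.map_congr (g := id), Measure.map_id]
  filter_upwards [setBernoulli_ae_subset] with s hs
  simp only [Function.comp_apply, SimpleGraph.edgeSet_fromEdgeSet, id_eq, sdiff_eq_left]
  exact Set.disjoint_left.2 fun e he h => hs he h

/-- The law of the indicator of the pair `e` being an edge of the binomial random graph;
on the diagonal of `Sym2 V` the indicator is almost surely false. -/
noncomputable def edgeLaw {V : Type*} (p : I) (e : Sym2 V) : Measure Prop :=
  toNNReal p • Measure.dirac (e ∈ (Sym2.diagSetᶜ : Set (Sym2 V))) +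
    toNNReal (σ p) • Measure.dirac False

instance {V : Type*} (p : I) (e : Sym2 V) : IsProbabilityMeasure (edgeLaw p e) := by
  unfold edgeLaw; infer_instance

theorem measurable_edgeIndicators {V : Type*} :
    Measurable (fun (G : SimpleGraph V) (e : Sym2 V) => e ∈ G.edgeSet) :=
  measurable_set_iff.1 SimpleGraph.measurable_edgeSet |> measurable_pi_iff.2

instance {V : Type*} [Finite V] : DiscreteMeasurableSpace (SimpleGraph V) where
  forall_measurableSet s := by
    rw [← SimpleGraph.edgeSet_injective.preimage_image s]
    exact SimpleGraph.measurable_edgeSet .of_discrete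

theorem map_edgeIndicators_binomialRandom {V : Type*} [Fintype V] (p : I) :
    (SimpleGraph.binomialRandom V p).map (fun G e => e ∈ G.edgeSet) =
      Measure.pi (fun e : Sym2 V => edgeLaw p e) := by
  have h : (fun (G : SimpleGraph V) (e : Sym2 V) => e ∈ G.edgeSet) =
      (fun (s : Set (Sym2 V)) e => e ∈ s) ∘ SimpleGraph.edgeSet := rfl
  have hm : Measurable (fun (s : Set (Sym2 V)) e => e ∈ s) :=
    MeasurableEquiv.setOfPred.symm.measurable
  have hm' : Measurable (fun x : Sym2 V → Prop => {e | x e}) :=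
    MeasurableEquiv.setOfPred.measurable
  rw [h, ← Measure.map_map hm SimpleGraph.measurable_edgeSet, map_edgeSet_binomialRandom,
    setBernoulli_eq_map, Measure.map_map hm hm', Measure.infinitePi_eq_pi]
  exact Measure.map_id

theorem iIndepFun_edgeIndicators {V : Type*} [Fintype V] (p : I) :
    iIndepFun (fun (e : Sym2 V) (G : SimpleGraph V) => e ∈ G.edgeSet)
      (SimpleGraph.binomialRandom V p) := by
  have hm : ∀ e : Sym2 V, Measurable fun G : SimpleGraph V => e ∈ G.edgeSet :=
    measurable_pi_iff.1 measurable_edgeIndicators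
  rw [iIndepFun_iff_map_fun_eq_pi_map fun e => (hm e).aemeasurable,
    map_edgeIndicators_binomialRandom]
  congr 1
  ext1 e
  rw [← (measurePreserving_eval (fun e : Sym2 V => edgeLaw p e) e).map_eq,
    ← map_edgeIndicators_binomialRandom, Measure.map_map (measurable_pi_apply e)
      measurable_edgeIndicators]
  rfl

theorem integral_edgeLaw {V : Type*} (p : I) {e : Sym2 V} (he : ¬ e.IsDiag) (f : Prop → ℝ) :
    ∫ x, f x ∂edgeLaw p e = p * f True + (1 - p) * f False := by
  have he' : (e ∈ (Sym2.diagSetᶜ : Set (Sym2 V))) = True := by simpa using he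
  rw [edgeLaw, integral_add_measure (.of_finite) (.of_finite), he']
  simp [integral_smul_nnreal_measure, NNReal.smul_def]

/-- The expectation of a product of functions of distinct edge indicators is the product of the
expectations. -/
theorem integral_prod_edgeIndicators {V : Type*} [Fintype V] (p : I) (F : Finset (Sym2 V))
    (hF : ∀ e ∈ F, ¬ e.IsDiag) (f : Sym2 V → Prop → ℝ) :
    ∫ G, ∏ e ∈ F, f e (e ∈ G.edgeSet) ∂SimpleGraph.binomialRandom V p =
      ∏ e ∈ F, (p * f e True + (1 - p) * f e False) := by
  classical
  have h1 : ∀ x : Sym2 V → Prop, ∏ e ∈ F, f e (x e) =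
      ∏ e, (fun e y => if e ∈ F then f e y else 1) e (x e) := fun x => by
    simp [Finset.prod_ite_mem]
  calc _ = ∫ x, ∏ e ∈ F, f e (x e) ∂Measure.pi (fun e : Sym2 V => edgeLaw p e) := by
        rw [← map_edgeIndicators_binomialRandom,
          integral_map measurable_edgeIndicators.aemeasurable]
        exact (Measurable.of_discrete).aestronglyMeasurable
    _ = ∏ e, if e ∈ F then (p * f e True + (1 - p) * f e False) else 1 := by
        rw [integral_congr_ae (.of_forall h1)]
        refine (integral_fintype_prod_eq_prod (μ := fun e : Sym2 V => edgeLaw p e)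
          (fun e y => if e ∈ F then f e y else 1)).trans (Finset.prod_congr rfl fun e _ => ?_)
        split_ifs with he
        · exact integral_edgeLaw p (hF e he) _
        · simp
    _ = _ := by simp [Finset.prod_ite_mem]

/-- The edges at a vertex are independent of the graph formed by all other edges. -/
theorem indepFun_deleteIncidenceSet_neighborSet {V : Type*} [Fintype V] (p : I) (u : V) :
    IndepFun (fun G : SimpleGraph V => G.deleteIncidenceSet u) (fun G => G.neighborSet u)
      (SimpleGraph.binomialRandom V p) := by
  classical
  have h := (iIndepFun_edgeIndicators (V := V) p).indepFun_finset
    (Finset.univ.filter fun e => u ∉ e) (Finset.univ.filter fun e => u ∈ e)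
    (Finset.disjoint_filter.2 fun e _ h1 h2 => h1 h2)
    (measurable_pi_iff.1 measurable_edgeIndicators)
  have h2 := h.comp
    (φ := fun x => SimpleGraph.fromEdgeSet {e | ∃ h : u ∉ e, x ⟨e, by simpa using h⟩})
    (ψ := fun x => {v | x ⟨s(u, v), by simp⟩}) .of_discrete .of_discrete
  convert! h2 using 2 with G G
  · ext v w
    simp only [SimpleGraph.deleteIncidenceSet_adj, Function.comp_apply,
      SimpleGraph.fromEdgeSet_adj, Set.mem_ofPred_eq, SimpleGraph.mem_edgeSet, Sym2.mem_iff]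
    constructor
    · rintro ⟨h1, h2, h3⟩
      exact ⟨⟨by rintro (h | h) <;> simp_all, h1⟩, h1.ne⟩
    · rintro ⟨⟨h1, h2⟩, h3⟩
      exact ⟨h2, fun h => h1 (.inl h.symm), fun h => h1 (.inr h.symm)⟩

/-- A bound on the probability of `Y ∈ D x` that is uniform in `x` also holds for `Y ∈ D X`,
when `X` and `Y` are independent. -/
theorem measure_indep_le {Ω α β : Type*} [MeasurableSpace Ω] [MeasurableSpace α]
    [MeasurableSpace β] {μ : Measure Ω} [IsProbabilityMeasure μ] {X : Ω → α} {Y : Ω → β}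
    (hX : Measurable X) (hY : Measurable Y) (hXY : IndepFun X Y μ) {D : Set (α × β)}
    (hD : MeasurableSet D) {δ : ENNReal} (h : ∀ x, μ {ω | (x, Y ω) ∈ D} ≤ δ) :
    μ {ω | (X ω, Y ω) ∈ D} ≤ δ := by
  have h1 := (indepFun_iff_map_prod_eq_prod_map_map hX.aemeasurable hY.aemeasurable).1 hXY
  have : IsProbabilityMeasure (μ.map X) := Measure.isProbabilityMeasure_map hX.aemeasurable
  have : IsProbabilityMeasure (μ.map Y) := Measure.isProbabilityMeasure_map hY.aemeasurable
  calc μ {ω | (X ω, Y ω) ∈ D} = (μ.map fun ω => (X ω, Y ω)) D :=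
        (Measure.map_apply (hX.prodMk hY) hD).symm
    _ = ∫⁻ x, (μ.map Y) (Prod.mk x ⁻¹' D) ∂μ.map X := by rw [h1, Measure.prod_apply hD]
    _ ≤ ∫⁻ _, δ ∂μ.map X := by
        refine lintegral_mono fun x => ?_
        rw [Measure.map_apply hY (measurable_prodMk_left hD)]
        exact h x
    _ = δ := by simp

/-! ### Graphs in which large sets are joined by an edge -/

/-- Any two disjoint sets of at least `a` vertices are joined by an edge. -/
def LargeSetsJoined {V : Type*} (G : SimpleGraph V) (a : ℝ) : Prop :=
  ∀ S T : Finset V, Disjoint S T → a ≤ S.card → a ≤ T.card → ∃ s ∈ S, ∃ t ∈ T, G.Adj s t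

theorem LargeSetsJoined.mono {V : Type*} {G : SimpleGraph V} {a b : ℝ}
    (h : LargeSetsJoined G a) (hab : a ≤ b) : LargeSetsJoined G b :=
  fun S T hST hS hT => h S T hST (hab.trans hS) (hab.trans hT)

theorem LargeSetsJoined.deleteIncidenceSet {V : Type*} {G : SimpleGraph V} {a : ℝ}
    (h : LargeSetsJoined G a) (u : V) : LargeSetsJoined (G.deleteIncidenceSet u) (a + 1) := by
  classical
  have hcard : ∀ S : Finset V, a + 1 ≤ S.card → a ≤ (S.erase u).card := fun S hS => by
    have : (S.card : ℝ) ≤ (S.erase u).card + 1 := by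
      exact_mod_cast (Nat.sub_le_iff_le_add.1 Finset.pred_card_le_card_erase)
    linarith
  intro S T hST hS hT
  obtain ⟨s, hs, t, ht, hadj⟩ := h (S.erase u) (T.erase u)
    (hST.mono (Finset.erase_subset _ _) (Finset.erase_subset _ _)) (hcard S hS) (hcard T hT)
  rw [Finset.mem_erase] at hs ht
  exact ⟨s, hs.2, t, ht.2, SimpleGraph.deleteIncidenceSet_adj.2 ⟨hadj, hs.1, ht.1⟩⟩

/-- If large sets are joined, then some component contains nearly all vertices: a smallest set of
at least `a` vertices that is a union of components consists of one component. -/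
theorem LargeSetsJoined.exists_component {V : Type*} [Fintype V] {G : SimpleGraph V} {a : ℝ}
    (h : LargeSetsJoined G a) (ha : 0 < a) (hcard : 3 * a ≤ Fintype.card V) :
    ∃ C : G.ConnectedComponent, Fintype.card V - a < C.supp.ncard := by
  classical
  let closed : Finset V → Prop := fun U => ∀ v w, G.Adj v w → v ∈ U → w ∈ U
  have hcompl : ∀ U : Finset V, closed U → a ≤ U.card → Fintype.card V - a < U.card := by
    intro U hU hUa
    by_contra! hlt
    have hc : (Uᶜ.card : ℝ) = Fintype.card V - U.card := by
      rw [Finset.card_compl, Nat.cast_sub (Finset.card_le_univ U)]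
    obtain ⟨s, hs, t, ht, hadj⟩ := h U Uᶜ disjoint_compl_right hUa (by linarith)
    exact (Finset.mem_compl.1 ht) (hU s t hadj hs)
  obtain ⟨U, hU, hmin⟩ := Finset.exists_min_image
    (Finset.univ.filter fun U : Finset V => closed U ∧ a ≤ U.card) Finset.card
    ⟨Finset.univ, by
      simp only [Finset.mem_filter, Finset.mem_univ, true_and, Finset.card_univ]
      exact ⟨fun _ _ _ _ => Finset.mem_univ _, by linarith⟩⟩
  simp only [Finset.mem_filter, Finset.mem_univ, true_and] at hU hmin
  obtain ⟨hUc, hUa⟩ := hU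
  have hUpos : 0 < U.card := by exact_mod_cast ha.trans_le hUa
  obtain ⟨v, hv⟩ := Finset.card_pos.1 hUpos
  let K : Finset V := Finset.univ.filter fun w => G.Reachable v w
  have hvK : v ∈ K := by simp [K]
  have hKc : closed K := fun x y hxy hx => by
    simp only [K, Finset.mem_filter, Finset.mem_univ, true_and] at hx ⊢
    exact hx.trans hxy.reachable
  have hKsupp : (G.connectedComponentMk v).supp = K := by
    ext w
    simp [K, SimpleGraph.reachable_comm]
  refine ⟨G.connectedComponentMk v, ?_⟩
  rw [hKsupp, Set.ncard_coe_finset]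
  refine hcompl K hKc ?_
  by_contra! hKa
  have hUr : ∀ x y, G.Reachable x y → x ∈ U → y ∈ U := by
    rintro x y ⟨p⟩ hx
    induction p with
    | nil => exact hx
    | cons hadj p ih => exact ih (hUc _ _ hadj hx)
  have hKU : K ⊆ U := by
    intro w hw
    simp only [K, Finset.mem_filter, Finset.mem_univ, true_and] at hw
    exact hUr v w hw hv
  have hsd : ((U \ K).card : ℝ) = U.card - K.card := by
    rw [Finset.card_sdiff_of_subset hKU, Nat.cast_sub (Finset.card_le_card hKU)]
  have hKpos : 0 < K.card := Finset.card_pos.2 ⟨v, hvK⟩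
  -- Splitting off the small component `K` leaves fewer than `a` vertices, by minimality.
  have hlt : ((U \ K).card : ℝ) < a := by
    by_contra! hge
    have hcl : closed (U \ K) := fun x y hxy hx => by
      rw [Finset.mem_sdiff] at hx ⊢
      exact ⟨hUc x y hxy hx.1, fun hy => hx.2 (hKc y x hxy.symm hy)⟩
    have h1 := hmin (U \ K) ⟨hcl, hge⟩
    rw [Finset.card_sdiff_of_subset hKU] at h1
    omega
  have := hcompl U hUc hUa
  linarith

theorem inter_nonempty_of_card_lt_two_mul_ncard {V : Type*} [Fintype V] {A B : Set V}
    (hA : (Fintype.card V : ℝ) < 2 * A.ncard) (hB : (Fintype.card V : ℝ) < 2 * B.ncard) :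
    (A ∩ B).Nonempty := by
  by_contra! h
  have h1 := Set.ncard_union_eq (Set.disjoint_iff_inter_eq_empty.2 h)
  have h2 : ((A ∪ B).ncard : ℝ) ≤ Fintype.card V := by
    rw [← Nat.card_eq_fintype_card]
    exact_mod_cast Set.ncard_le_card _
  rw [h1] at h2
  push_cast at h2
  linarith

theorem component_eq_of_card_lt_two_mul_ncard {V : Type*} [Fintype V] {G : SimpleGraph V}
    {C D : G.ConnectedComponent} (hC : (Fintype.card V : ℝ) < 2 * C.supp.ncard)
    (hD : (Fintype.card V : ℝ) < 2 * D.supp.ncard) : C = D := by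
  obtain ⟨v, hv, hv'⟩ := inter_nonempty_of_card_lt_two_mul_ncard hC hD
  exact hv.symm.trans hv'

theorem neighborDist_real {V : Type*} [Fintype V] [MeasurableSpace V] [MeasurableSingletonClass V]
    (G : SimpleGraph V) (u : V) (A : Set V) :
    (neighborDist G u).real (G.neighborSet u ∩ A) =
      (G.neighborSet u ∩ A).ncard / (G.neighborSet u).ncard := by
  classical
  have h := uniformOn_apply_finset (s := (G.neighborSet u).toFinset)
    (t := (G.neighborSet u ∩ A).toFinset)
  rw [Set.coe_toFinset, Set.coe_toFinset] at h
  rw [neighborDist, measureReal_def, h, Set.ncard_eq_toFinset_card', Set.ncard_eq_toFinset_card']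
  have h2 : (G.neighborSet u).toFinset ∩ (G.neighborSet u ∩ A).toFinset =
      (G.neighborSet u ∩ A).toFinset := by
    ext; simp
  rw [h2]
  simp

/-- Some component of `G` has more than three quarters of the vertices, and yet more than two
thirds of `N` lie outside it. -/
def MissedByGiant {V : Type*} [Fintype V] (G : SimpleGraph V) (N : Set V) : Prop :=
  ∃ C : G.ConnectedComponent, 3 / 4 * (Fintype.card V : ℝ) < C.supp.ncard ∧
    2 * (N ∩ C.supp).ncard < (N \ C.supp).ncard

/-- Since the giant components of the graphs `G - u` all lie in the giant component of `G`, it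
suffices that a third of the neighbourhood of each `u` lies in the giant component of `G - u`. -/
theorem admissible_of_largeSetsJoined {V : Type*} [Fintype V] [MeasurableSpace V]
    [MeasurableSingletonClass V] {Gs H : SimpleGraph V} (hV : 40 ≤ Fintype.card V)
    (hG : LargeSetsJoined (Gs ⊓ H) (Fintype.card V / 8))
    (hN : ∀ u, ¬ MissedByGiant (Gs.deleteIncidenceSet u ⊓ H) (Gs.neighborSet u)) :
    Admissible Gs (Gs ⊓ H) (1 / 3) := by
  have hV' : (40 : ℝ) ≤ Fintype.card V := by exact_mod_cast hV
  obtain ⟨C, hC⟩ := hG.exists_component (by linarith) (by linarith)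
  refine ⟨C, fun u hu => ?_⟩
  have hdel : (Gs ⊓ H).deleteIncidenceSet u = Gs.deleteIncidenceSet u ⊓ H := by
    ext v w
    simp only [SimpleGraph.deleteIncidenceSet_adj, SimpleGraph.inf_adj]
    tauto
  have hGu := (hG.deleteIncidenceSet u).mono
    (show _ ≤ (Fintype.card V : ℝ) / 5 by linarith)
  rw [hdel] at hGu
  obtain ⟨D, hD⟩ := hGu.exists_component (by linarith) (by linarith)
  have hle : Gs.deleteIncidenceSet u ⊓ H ≤ Gs ⊓ H :=
    inf_le_inf_right _ (Gs.deleteIncidenceSet_le u)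
  have hDC : D.supp ⊆ C.supp := by
    obtain ⟨v, hvD, hvC⟩ := inter_nonempty_of_card_lt_two_mul_ncard (A := D.supp) (B := C.supp)
      (by linarith) (by linarith)
    intro w hw
    have hr : (Gs.deleteIncidenceSet u ⊓ H).Reachable w v :=
      SimpleGraph.ConnectedComponent.exact (hw.trans hvD.symm)
    exact (SimpleGraph.ConnectedComponent.sound (hr.mono hle)).trans hvC
  have hnot : (Gs.neighborSet u \ D.supp).ncard ≤ 2 * (Gs.neighborSet u ∩ D.supp).ncard := by
    by_contra! hlt
    exact hN u ⟨D, by linarith, hlt⟩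
  have hsum := Set.ncard_inter_add_ncard_sdiff_eq_ncard (Gs.neighborSet u) D.supp
  have hmono : (Gs.neighborSet u ∩ D.supp).ncard ≤ (Gs.neighborSet u ∩ C.supp).ncard :=
    Set.ncard_le_ncard (Set.inter_subset_inter_right _ hDC)
  have hpos : 0 < (Gs.neighborSet u).ncard := (Set.ncard_pos).2 hu
  rw [neighborDist_real, div_le_div_iff₀ (by norm_num) (by exact_mod_cast hpos)]
  have : (Gs.neighborSet u).ncard ≤ 3 * (Gs.neighborSet u ∩ C.supp).ncard := by omega
  have : ((Gs.neighborSet u).ncard : ℝ) ≤ 3 * (Gs.neighborSet u ∩ C.supp).ncard := by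
    exact_mod_cast this
  linarith

/-! ### Tail bounds for joined sets and for neighbourhoods -/

theorem measureReal_no_edge_le {V : Type*} [Fintype V] (p η : I) {S T : Finset V}
    (hST : Disjoint S T) :
    ((SimpleGraph.binomialRandom V p).prod (SimpleGraph.binomialRandom V η)).real
      {ω | ∀ s ∈ S, ∀ t ∈ T, ¬ (ω.1 ⊓ ω.2).Adj s t} ≤
      Real.exp (-(p * η * (S.card * T.card))) := by
  classical
  let μ := (SimpleGraph.binomialRandom V p).prod (SimpleGraph.binomialRandom V η)
  let F : Finset (Sym2 V) := (S ×ˢ T).image fun x => s(x.1, x.2)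
  have hinj : Set.InjOn (fun x : V × V => s(x.1, x.2)) ↑(S ×ˢ T) := by
    rintro ⟨a, b⟩ h1 ⟨c, d⟩ h2 h
    simp only [Finset.coe_product, Set.mem_prod, Finset.mem_coe] at h1 h2
    rcases Sym2.eq_iff.1 h with h | ⟨rfl, -⟩
    · exact Prod.ext h.1 h.2
    · -- A pair swapped into another one would put its first entry in both `S` and `T`.
      exact absurd h2.2 (Finset.disjoint_left.1 hST h1.1)
  have hFcard : F.card = S.card * T.card := by
    rw [Finset.card_image_of_injOn hinj, Finset.card_product]
  have hF : ∀ e ∈ F, ¬ e.IsDiag := by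
    intro e he
    obtain ⟨⟨a, b⟩, hab, rfl⟩ := Finset.mem_image.1 he
    rw [Finset.mem_product] at hab
    rw [Sym2.mk_isDiag_iff]
    intro h
    exact Finset.disjoint_left.1 hST hab.1 (h ▸ hab.2)
  let f : Prop → ℝ := fun x => if x then 1 - η else 1
  let g : Prop → Prop → ℝ := fun x y => if x ∧ y then 0 else 1
  have hind : ∀ ω : SimpleGraph V × SimpleGraph V,
      ({ω | ∀ s ∈ S, ∀ t ∈ T, ¬ (ω.1 ⊓ ω.2).Adj s t} : Set _).indicator 1 ω =
        ∏ e ∈ F, g (e ∈ ω.1.edgeSet) (e ∈ ω.2.edgeSet) := by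
    intro ω
    rw [Set.indicator_apply]
    split_ifs with h
    · refine (Finset.prod_eq_one fun e he => ?_).symm
      obtain ⟨⟨a, b⟩, hab, rfl⟩ := Finset.mem_image.1 he
      rw [Finset.mem_product] at hab
      exact if_neg (h a hab.1 b hab.2)
    · simp only [Set.mem_ofPred_eq, not_forall, not_not] at h
      obtain ⟨s, hs, t, ht, hst⟩ := h
      have hmem : s(s, t) ∈ F := Finset.mem_image.2 ⟨(s, t), Finset.mk_mem_product hs ht, rfl⟩
      refine (Finset.prod_eq_zero hmem ?_).symm
      exact if_pos hst
  have hin : ∀ G : SimpleGraph V,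
      ∫ H, ∏ e ∈ F, g (e ∈ G.edgeSet) (e ∈ H.edgeSet)
        ∂SimpleGraph.binomialRandom V η = ∏ e ∈ F, f (e ∈ G.edgeSet) := by
    intro G
    rw [integral_prod_edgeIndicators η F hF (fun e y => g (e ∈ G.edgeSet) y)]
    refine Finset.prod_congr rfl fun e _ => ?_
    by_cases he : e ∈ G.edgeSet <;> simp [f, g, he]
  calc _ = ∫ ω, ({ω | ∀ s ∈ S, ∀ t ∈ T, ¬ (ω.1 ⊓ ω.2).Adj s t} : Set _).indicator 1 ω ∂μ :=
        (integral_indicator_one .of_discrete).symm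
    _ = ∫ G, ∫ H, ∏ e ∈ F, g (e ∈ G.edgeSet) (e ∈ H.edgeSet)
        ∂SimpleGraph.binomialRandom V η ∂SimpleGraph.binomialRandom V p := by
        simp_rw [hind]
        exact integral_prod _ .of_finite
    _ = ∏ e ∈ F, (1 - p * η : ℝ) := by
        simp_rw [hin]
        rw [integral_prod_edgeIndicators p F hF (fun _ => f)]
        refine Finset.prod_congr rfl fun e _ => ?_
        simp only [f, if_true, if_false]
        ring
    _ ≤ _ := by
        have h0 : (0 : ℝ) ≤ 1 - p * η := by
          have := mul_le_one₀ p.2.2 η.2.1 η.2.2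
          linarith
        rw [Finset.prod_const, hFcard]
        refine (pow_le_pow_left₀ h0 (Real.one_sub_le_exp_neg _) _).trans_eq ?_
        rw [← Real.exp_nat_mul]
        push_cast
        ring_nf

/-- A union bound over the at most `4 ^ |V|` pairs of vertex sets. -/
theorem measureReal_not_largeSetsJoined_le {V : Type*} [Fintype V] (p η : I) {a : ℝ}
    (ha : 0 ≤ a) :
    ((SimpleGraph.binomialRandom V p).prod (SimpleGraph.binomialRandom V η)).real
      {ω | ¬ LargeSetsJoined (ω.1 ⊓ ω.2) a} ≤
      4 ^ Fintype.card V * Real.exp (-(p * η * a ^ 2)) := by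
  classical
  let μ := (SimpleGraph.binomialRandom V p).prod (SimpleGraph.binomialRandom V η)
  let P : Finset (Finset V × Finset V) := Finset.univ.filter fun x =>
    Disjoint x.1 x.2 ∧ a ≤ x.1.card ∧ a ≤ x.2.card
  have hP : (P.card : ℝ) ≤ 4 ^ Fintype.card V := by
    have h1 : P.card ≤ 2 ^ Fintype.card V * 2 ^ Fintype.card V := by
      refine (Finset.card_le_univ P).trans_eq ?_
      simp
    rw [← mul_pow] at h1
    exact_mod_cast h1
  have hsub : {ω : SimpleGraph V × SimpleGraph V | ¬ LargeSetsJoined (ω.1 ⊓ ω.2) a} ⊆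
      ⋃ x ∈ P, {ω | ∀ s ∈ x.1, ∀ t ∈ x.2, ¬ (ω.1 ⊓ ω.2).Adj s t} := by
    intro ω hω
    simp only [Set.mem_ofPred_eq, LargeSetsJoined] at hω
    push Not at hω
    obtain ⟨S, T, hST, hS, hT, h⟩ := hω
    refine Set.mem_biUnion (x := (S, T)) ?_ h
    simp [P, hST, hS, hT]
  calc _ ≤ μ.real (⋃ x ∈ P, {ω | ∀ s ∈ x.1, ∀ t ∈ x.2, ¬ (ω.1 ⊓ ω.2).Adj s t}) :=
        measureReal_mono hsub (measure_ne_top _ _)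
    _ ≤ ∑ x ∈ P, μ.real {ω | ∀ s ∈ x.1, ∀ t ∈ x.2, ¬ (ω.1 ⊓ ω.2).Adj s t} :=
        measureReal_biUnion_finset_le _ _
    _ ≤ ∑ x ∈ P, Real.exp (-(p * η * a ^ 2)) := by
        refine Finset.sum_le_sum fun x hx => ?_
        simp only [P, Finset.mem_filter, Finset.mem_univ, true_and] at hx
        refine (measureReal_no_edge_le p η hx.1).trans (Real.exp_le_exp.2 (neg_le_neg ?_))
        rw [sq]
        exact mul_le_mul_of_nonneg_left (mul_le_mul hx.2.1 hx.2.2 ha (ha.trans hx.2.1))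
          (mul_nonneg p.2.1 η.2.1)
    _ ≤ _ := by
        rw [Finset.sum_const, nsmul_eq_mul]
        exact mul_le_mul_of_nonneg_right hP (Real.exp_pos _).le

/-- The random neighbourhood of `u` is unlikely to have more than twice as many elements outside
a given set of at least three quarters of the vertices as inside. -/
theorem measure_neighborSet_misses_le {V : Type*} [Fintype V] (p : I) (u : V) (W : Set V)
    (hV : 12 ≤ Fintype.card V) (hW : 3 / 4 * (Fintype.card V : ℝ) < W.ncard) :
    (SimpleGraph.binomialRandom V p) {G | 2 * (G.neighborSet u ∩ W).ncard <
      (G.neighborSet u \ W).ncard} ≤ ENNReal.ofReal (Real.exp (-(p * Fintype.card V / 4))) := by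
  classical
  have hV' : (12 : ℝ) ≤ Fintype.card V := by exact_mod_cast hV
  let μ := SimpleGraph.binomialRandom V p
  let B : Set (SimpleGraph V) :=
    {G | 2 * (G.neighborSet u ∩ W).ncard < (G.neighborSet u \ W).ncard}
  let F : Finset (Sym2 V) := (Finset.univ.erase u).image fun v => s(u, v)
  have hinj : Set.InjOn (fun v : V => s(u, v)) ↑(Finset.univ.erase u) :=
    fun v _ w _ h => Sym2.congr_right.1 h
  have hF : ∀ e ∈ F, ¬ e.IsDiag := by
    intro e he
    obtain ⟨v, hv, rfl⟩ := Finset.mem_image.1 he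
    rw [Sym2.mk_isDiag_iff]
    exact (Finset.ne_of_mem_erase hv).symm
  -- The product of the weights over the neighbours of `u` is `2 ^ (Y - 2 X)`, where `X` and `Y`
  -- count the neighbours inside and outside `W`; it is at least `1` on the event in question.
  let c : Sym2 V → ℝ := fun e => if ∃ w ∈ W, e = s(u, w) then 1 / 4 else 2
  have hc : ∀ v, c s(u, v) = if v ∈ W then 1 / 4 else 2 := fun v => by
    simp only [c, Sym2.congr_right, exists_eq_right']
  let f : Sym2 V → Prop → ℝ := fun e y => if y then c e else 1
  let Φ : SimpleGraph V → ℝ := fun G => ∏ e ∈ F, f e (e ∈ G.edgeSet)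
  have hΦ : ∀ G : SimpleGraph V, Φ G =
      (1 / 4) ^ (G.neighborSet u ∩ W).ncard * 2 ^ (G.neighborSet u \ W).ncard := by
    intro G
    have h1 : (Finset.univ.erase u).filter (fun v => G.Adj u v) = (G.neighborSet u).toFinset := by
      ext v
      simp only [Finset.mem_filter, Finset.mem_erase, Finset.mem_univ, and_true,
        Set.mem_toFinset, SimpleGraph.mem_neighborSet, and_iff_right_iff_imp]
      exact fun h => h.ne'
    simp only [Φ, f, F]
    rw [Finset.prod_image hinj]
    simp only [SimpleGraph.mem_edgeSet, hc]
    rw [← Finset.prod_filter, h1, Finset.prod_ite, Finset.prod_const, Finset.prod_const,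
      Set.ncard_eq_toFinset_card', Set.ncard_eq_toFinset_card']
    congr 3
    · ext; simp
    · ext; simp
  have hind : ∀ G, B.indicator 1 G ≤ Φ G := by
    intro G
    rw [hΦ, Set.indicator_apply]
    split_ifs with h
    · have h2 : 2 * (G.neighborSet u ∩ W).ncard ≤ (G.neighborSet u \ W).ncard := h.le
      have h3 := pow_le_pow_right₀ (one_le_two (α := ℝ)) h2
      rw [pow_mul] at h3
      calc (1 : SimpleGraph V → ℝ) G = (1 / 4) ^ (G.neighborSet u ∩ W).ncard *
            (2 ^ 2) ^ (G.neighborSet u ∩ W).ncard := by rw [← mul_pow]; norm_num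
        _ ≤ _ := mul_le_mul_of_nonneg_left h3 (by positivity)
    · positivity
  -- The expectation of the product is controlled by the sum of `weight - 1` over all `v ≠ u`.
  have hsum : ∑ v ∈ Finset.univ.erase u, ((if v ∈ W then 1 / 4 else 2 : ℝ) - 1) ≤
      -(Fintype.card V / 4 : ℝ) := by
    have h1 : ∀ v, ((if v ∈ W then 1 / 4 else 2 : ℝ) - 1) =
        1 - 7 / 4 * (if v ∈ W then 1 else 0) := fun v => by split_ifs <;> norm_num
    have h2 : ∑ v, ((if v ∈ W then 1 / 4 else 2 : ℝ) - 1) =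
        Fintype.card V - 7 / 4 * W.ncard := by
      simp_rw [h1]
      rw [Finset.sum_sub_distrib, ← Finset.mul_sum, Finset.sum_boole,
        Set.ncard_eq_toFinset_card']
      simp only [Finset.sum_const, Finset.card_univ, nsmul_eq_mul, mul_one]
      congr 4
      ext; simp
    have h3 := Finset.add_sum_erase Finset.univ
      (fun v => (if v ∈ W then 1 / 4 else 2 : ℝ) - 1) (Finset.mem_univ u)
    have h4 : (-(3 / 4) : ℝ) ≤ (if u ∈ W then 1 / 4 else 2 : ℝ) - 1 := by
      split_ifs <;> norm_num
    simp only [h2] at h3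
    linarith
  have hmain : μ.real B ≤ Real.exp (-(p * Fintype.card V / 4)) := by
    calc μ.real B = ∫ G, B.indicator 1 G ∂μ := (integral_indicator_one .of_discrete).symm
      _ ≤ ∫ G, Φ G ∂μ := integral_mono .of_finite .of_finite hind
      _ = ∏ e ∈ F, (1 + p * (c e - 1)) := by
          refine (integral_prod_edgeIndicators p F hF f).trans
            (Finset.prod_congr rfl fun e _ => ?_)
          simp only [f, if_true, if_false]
          ring
      _ = ∏ v ∈ Finset.univ.erase u, (1 + p * ((if v ∈ W then 1 / 4 else 2 : ℝ) - 1)) := by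
          rw [Finset.prod_image hinj]
          simp only [hc]
      _ ≤ ∏ v ∈ Finset.univ.erase u, Real.exp (p * ((if v ∈ W then 1 / 4 else 2 : ℝ) - 1)) := by
          refine Finset.prod_le_prod (fun v _ => ?_) fun v _ => ?_
          · have h0 := p.2.1
            have h1 := p.2.2
            split_ifs <;> linarith
          · rw [add_comm]
            exact Real.add_one_le_exp _
      _ ≤ _ := by
          rw [← Real.exp_sum, ← Finset.mul_sum]
          refine Real.exp_le_exp.2 ?_
          have := mul_le_mul_of_nonneg_left hsum p.2.1
          linarith
  rw [← ENNReal.ofReal_toReal (measure_ne_top μ B)]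
  exact ENNReal.ofReal_le_ofReal hmain

/-- The giant component of the retained graph away from `u` is determined by edges that are
independent of the neighbourhood of `u`, so it may be treated as a fixed set. -/
theorem measureReal_missedByGiant_le {V : Type*} [Fintype V] (p η : I) (u : V)
    (hV : 12 ≤ Fintype.card V) :
    ((SimpleGraph.binomialRandom V p).prod (SimpleGraph.binomialRandom V η)).real
      {ω | MissedByGiant (ω.1.deleteIncidenceSet u ⊓ ω.2) (ω.1.neighborSet u)} ≤
      Real.exp (-(p * Fintype.card V / 4)) := by
  refine ENNReal.toReal_le_of_le_ofReal (Real.exp_pos _).le ?_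
  rw [Measure.prod_apply_symm .of_discrete]
  have hH : ∀ H : SimpleGraph V, (SimpleGraph.binomialRandom V p)
      {G | MissedByGiant (G.deleteIncidenceSet u ⊓ H) (G.neighborSet u)} ≤
        ENNReal.ofReal (Real.exp (-(p * Fintype.card V / 4))) := by
    intro H
    refine measure_indep_le (D := {x | MissedByGiant (x.1 ⊓ H) x.2}) .of_discrete .of_discrete
      (indepFun_deleteIncidenceSet_neighborSet p u) .of_discrete fun K => ?_
    by_cases hK : ∃ C : (K ⊓ H).ConnectedComponent,
        3 / 4 * (Fintype.card V : ℝ) < C.supp.ncard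
    · obtain ⟨C, hC⟩ := hK
      refine (measure_mono ?_).trans (measure_neighborSet_misses_le p u C.supp hV hC)
      rintro G ⟨D, hD, hlt⟩
      have hpos : (12 : ℝ) ≤ Fintype.card V := by exact_mod_cast hV
      rwa [component_eq_of_card_lt_two_mul_ncard (C := D) (D := C) (by linarith)
        (by linarith)] at hlt
    · have hempty : {G : SimpleGraph V |
          (K, G.neighborSet u) ∈ {x | MissedByGiant (x.1 ⊓ H) x.2}} = ∅ := by
        ext G
        simp only [Set.mem_ofPred_eq, Set.mem_empty_iff_false, iff_false]
        rintro ⟨C, hC, -⟩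
        exact hK ⟨C, hC⟩
      rw [hempty, measure_empty]
      exact zero_le
  exact (lintegral_mono hH).trans_eq (by simp)

/-! ### The survival probability -/

/-- The positive fixed point of `γ ↦ 1 - exp (-c γ)`, the survival probability of a branching
process with Poisson offspring of mean `c`. -/
theorem existsUnique_survival {c : ℝ} (hc : 2 ≤ c) :
    ∃! γ : ℝ, γ ∈ Set.Ioc (0 : ℝ) 1 ∧ γ = 1 - Real.exp (-(c * γ)) := by
  have hcont : ContinuousOn (fun x : ℝ => 1 - Real.exp (-(c * x)) - x) (Set.Icc (1 / 2) 1) := by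
    fun_prop
  have h1 : 1 - Real.exp (-(c * 1)) - 1 ≤ 0 := by
    have := Real.exp_pos (-(c * 1))
    linarith
  have h2 : 0 ≤ 1 - Real.exp (-(c * (1 / 2))) - 1 / 2 := by
    have h3 : Real.exp (-(c * (1 / 2))) ≤ Real.exp (-1) := Real.exp_le_exp.2 (by linarith)
    have h4 := Real.exp_neg_one_lt_half
    linarith
  obtain ⟨γ, hγ, hγ0⟩ := intermediate_value_Icc' (by norm_num) hcont ⟨h1, h2⟩
  have hlt : ∀ a b : ℝ, 0 < a → a < b → a = 1 - Real.exp (-(c * a)) →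
      b = 1 - Real.exp (-(c * b)) → False := by
    intro a b ha hab ea eb
    have hb : 0 < b := ha.trans hab
    -- `a` lies strictly between `0` and `b`, and `x ↦ exp (-c x)` is strictly convex.
    have h := strictConvexOn_exp.2 (Set.mem_univ (-(c * b))) (Set.mem_univ 0)
      (by nlinarith) (div_pos ha hb) (sub_pos.2 ((div_lt_one hb).2 hab))
      (add_sub_cancel (a / b) 1)
    have h5 : a / b * b = a := div_mul_cancel₀ a hb.ne'
    simp only [smul_eq_mul, Real.exp_zero, mul_zero, add_zero, mul_one] at h
    rw [show a / b * -(c * b) = -(c * (a / b * b)) by ring, h5,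
      show Real.exp (-(c * a)) = 1 - a by linarith, show Real.exp (-(c * b)) = 1 - b by linarith,
      mul_sub, h5] at h
    linarith
  refine ⟨γ, ⟨⟨by linarith [hγ.1], hγ.2⟩, by linarith⟩, ?_⟩
  rintro δ ⟨hδ, hδ'⟩
  have hγ' : γ = 1 - Real.exp (-(c * γ)) := by linarith
  have hγpos : 0 < γ := by linarith [hγ.1]
  rcases lt_trichotomy δ γ with h | h | h
  · exact (hlt δ γ hδ.1 h hδ' hγ').elim
  · exact h
  · exact (hlt γ δ hγpos h hγ' hδ').elim

end KnowledgeGraph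

/-! ### Assembly of the bounds -/

theorem mainTheorem2 :
    ∃ C₀ : ℝ, 0 < C₀ ∧ ∃ ε : ℕ → ℝ,
      Asymptotics.IsLittleO Filter.atTop ε (fun n : ℕ => 1 / (n : ℝ) ^ 2) ∧
      ∀ (n : ℕ) (p η : unitInterval), 2 ≤ n →
        C₀ * (Real.log n / n) < (p : ℝ) →
        1 / Real.log n < (η : ℝ) →
        (∃! γ : ℝ, γ ∈ Set.Ioc (0 : ℝ) 1 ∧ γ = 1 - Real.exp (-(n * p * η * γ))) ∧
        ∀ γ : ℝ, γ ∈ Set.Ioc (0 : ℝ) 1 → γ = 1 - Real.exp (-(n * p * η * γ)) →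
          1 - ε n ≤ (KnowledgeGraph.thinnedLaw n p η).real
            {ω | KnowledgeGraph.Admissible ω.1 ω.2 (γ / 3)} := by
  refine ⟨1000, by norm_num, fun n => 2 * (1 / (n : ℝ) ^ 3), ?_, ?_⟩
  · refine Asymptotics.IsLittleO.const_mul_left ?_ _
    simp only [one_div, ← inv_pow]
    refine Asymptotics.IsLittleO.comp_tendsto (f := fun x : ℝ => x ^ 3) (g := fun x : ℝ => x ^ 2)
      (Asymptotics.isLittleO_pow_pow (by norm_num)) ?_
    exact tendsto_inv_atTop_zero.comp tendsto_natCast_atTop_atTop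
  intro n p η hn hp hη
  have hn0 : (0 : ℝ) < n := by exact_mod_cast (by omega : 0 < n)
  have hlogpos : 0 < Real.log n := Real.log_pos (by exact_mod_cast (by omega : 1 < n))
  -- The interval for `η` is nonempty only if `log n > 1`, and then `p ≤ 1` forces `n > 1000`.
  have hlog : 1 < Real.log n := by
    have := hη.trans_le η.2.2
    rwa [div_lt_one hlogpos] at this
  have hpn : 1000 * Real.log n < (n : ℝ) * p := by
    rw [← mul_div_assoc, div_lt_iff₀ hn0] at hp
    linarith
  have hn1000 : (1000 : ℝ) < n := by
    have := mul_le_of_le_one_right hn0.le p.2.2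
    linarith
  have hpη : 1000 < (n : ℝ) * p * η := by
    have h1 : 1 < η * Real.log n := by rwa [div_lt_iff₀ hlogpos] at hη
    have h2 : 0 < (η : ℝ) := (by positivity : 0 < 1 / Real.log n).trans hη
    have h3 := mul_lt_mul_of_pos_right hpn h2
    linarith
  refine ⟨KnowledgeGraph.existsUnique_survival (by linarith), fun γ hγ _ => ?_⟩
  have hcard : Fintype.card (Fin n) = n := Fintype.card_fin n
  have hn40 : 1000 < n := by exact_mod_cast hn1000
  let μ := (SimpleGraph.binomialRandom (Fin n) p).prod (SimpleGraph.binomialRandom (Fin n) η)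
  let E : Set (SimpleGraph (Fin n) × SimpleGraph (Fin n)) :=
    {ω | ¬ KnowledgeGraph.LargeSetsJoined (ω.1 ⊓ ω.2) (n / 8)}
  let B : Fin n → Set (SimpleGraph (Fin n) × SimpleGraph (Fin n)) := fun u =>
    {ω | KnowledgeGraph.MissedByGiant (ω.1.deleteIncidenceSet u ⊓ ω.2) (ω.1.neighborSet u)}
  let A : Set (SimpleGraph (Fin n) × SimpleGraph (Fin n)) :=
    {ω | KnowledgeGraph.Admissible ω.1 (ω.1 ⊓ ω.2) (γ / 3)}
  have hexp3 : Real.exp (-(3 * Real.log n)) = 1 / (n : ℝ) ^ 3 := by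
    rw [Real.exp_neg, mul_comm, Real.exp_mul, Real.exp_log hn0, one_div]
    norm_cast
  have hE : μ.real E ≤ 1 / (n : ℝ) ^ 3 := by
    have h := KnowledgeGraph.measureReal_not_largeSetsJoined_le (V := Fin n) p η
      (a := n / 8) (by positivity)
    refine h.trans ?_
    have h4 : (4 : ℝ) ≤ Real.exp 2 := by
      have := Real.quadratic_le_exp_of_nonneg (show (0 : ℝ) ≤ 2 by norm_num)
      linarith
    rw [hcard, ← hexp3]
    calc (4 : ℝ) ^ n * Real.exp (-(p * η * (n / 8) ^ 2))
        ≤ Real.exp 2 ^ n * Real.exp (-(p * η * (n / 8) ^ 2)) := by gcongr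
      _ = Real.exp (n * 2 - n * p * η * n / 64) := by
          rw [← Real.exp_nat_mul, ← Real.exp_add]
          ring_nf
      _ ≤ Real.exp (-(3 * Real.log n)) := by
          refine Real.exp_le_exp.2 ?_
          have h5 := mul_lt_mul_of_pos_right hpη hn0
          have h6 := Real.log_le_sub_one_of_pos hn0
          linarith
  have hB : ∀ u, μ.real (B u) ≤ 1 / (n : ℝ) ^ 4 := by
    intro u
    refine (KnowledgeGraph.measureReal_missedByGiant_le p η u (by omega)).trans ?_
    have hexp4 : Real.exp (-(4 * Real.log n)) = 1 / (n : ℝ) ^ 4 := by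
      rw [Real.exp_neg, mul_comm, Real.exp_mul, Real.exp_log hn0, one_div]
      norm_cast
    rw [hcard, ← hexp4]
    refine Real.exp_le_exp.2 ?_
    linarith
  have hsub : Aᶜ ⊆ E ∪ ⋃ u ∈ (Finset.univ : Finset (Fin n)), B u := by
    intro ω hω
    by_contra hgood
    simp only [Set.mem_union, Set.mem_iUnion, Finset.mem_univ, exists_prop, true_and, not_or,
      not_exists] at hgood
    refine hω ?_
    have hE' : KnowledgeGraph.LargeSetsJoined (ω.1 ⊓ ω.2)
        ((Fintype.card (Fin n) : ℝ) / 8) := by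
      rw [hcard]
      exact not_not.1 hgood.1
    obtain ⟨C, hC⟩ := KnowledgeGraph.admissible_of_largeSetsJoined (by omega) hE' hgood.2
    -- Only `γ ≤ 1` matters here: a third of every neighbourhood lies in the giant component.
    exact ⟨C, fun u hu => le_trans (by linarith [hγ.2]) (hC u hu)⟩
  have hAc : μ.real Aᶜ ≤ 2 * (1 / (n : ℝ) ^ 3) := by
    calc μ.real Aᶜ ≤ μ.real (E ∪ ⋃ u ∈ (Finset.univ : Finset (Fin n)), B u) :=
          measureReal_mono hsub
      _ ≤ μ.real E + μ.real (⋃ u ∈ (Finset.univ : Finset (Fin n)), B u) :=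
          measureReal_union_le _ _
      _ ≤ 1 / (n : ℝ) ^ 3 + ∑ _u : Fin n, 1 / (n : ℝ) ^ 4 :=
          add_le_add hE ((measureReal_biUnion_finset_le _ _).trans
            (Finset.sum_le_sum fun u _ => hB u))
      _ = 2 * (1 / (n : ℝ) ^ 3) := by
          rw [Finset.sum_const, Finset.card_univ, hcard, nsmul_eq_mul]
          field_simp
          norm_num
  have hA : μ.real A = 1 - μ.real Aᶜ := by
    have := probReal_compl_eq_one_sub (μ := μ) (s := A) .of_discrete
    linarith
  have hlaw : (KnowledgeGraph.thinnedLaw n p η).real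
      {ω | KnowledgeGraph.Admissible ω.1 ω.2 (γ / 3)} = μ.real A :=
    map_measureReal_apply (KnowledgeGraph.measurable_thinning n) .of_discrete
  rw [hlaw, hA]
  linarith
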